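/- Let $z\in\mathbb{R}$ be algebraic over $\mathbb{Q}$ of degree at most $2$, let $0<\alpha<1$, and let $x_n=\{nz\}$ ($n\ge 1$) be the Kronecker sequence of $z$, where $\{\cdot\}$ denotes the fractional part. For $N\ge 1$, the gap lengths of the set of points $\{x_1,\dots,x_N\}\subset[0,1)$ are the lengths of the arcs between neighbouring (distinct) points when the set is placed on the circle $\mathbb{R}/\mathbb{Z}$ of length $1$ (if the set is a single point, the only gap length is $1$). Let $1\le N_1<N_2<\cdots$ be any sequence of integers for which there is an integer $s\ge 1$ such that, for every $i$, the set $\{x_1,\dots,x_{N_i}\}$ has exactly $s$ different gap lengths $L^{(i)}_1<L^{(i)}_2<\dots<L^{(i)}_s$. For $\beta>0$, call the $j$-th gap length $\beta$-small if $\lim_{i\to\infty}N_i^{\beta}L^{(i)}_j=0$, and $\beta$-intermediate if there are constants $K_1,K_2>0$ such that $K_1/N_i^{\beta}\le L^{(i)}_j\le K_2/N_i^{\beta}$ for all $i$. Then, for every such sequence $(N_i)$: 1. (Obstruction 1 does not occur.) No $j\in\{1,\dots,s\}$ is such that the $j$-th gap length is $\alpha$-intermediate. 2. (Obstruction 2 does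 not occur.) There is no $j\in\{1,\dots,s\}$ such that the $j$-th gap length is the largest $\alpha$-small one (that is, it is $\alpha$-small and for no $k$ with $j<k\le s$ is the $k$-th gap length $\alpha$-small) and is also $1$-small. -/

import Mathlib

open Filter Topology

noncomputable section

/-- The Kronecker sequence `n ↦ {n z}`, where `{·}` is the fractional part. -/
def kronecker (z : ℝ) (n : ℕ) : ℝ := Int.fract ((n : ℝ) * z)

/-- The set of points `{x₁, …, x_N}` of a sequence (indices start at `1`). -/
def firstPoints (x : ℕ → ℝ) (N : ℕ) : Finset ℝ := (Finset.Icc 1 N).image x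

/-- The length of the arc that leads from `p` to `q` in the positive direction on the circle
`ℝ / ℤ` of length one: the unique `t ∈ (0, 1]` such that `p + t - q` is an integer. In particular
the arc from a point to itself is the whole circle and has length `1`. -/
def arcLength (p q : ℝ) : ℝ := 1 - Int.fract (p - q)

/-- The set of the different gap lengths of a finite set of points of `[0, 1)`, placed on the
circle: the lengths of the arcs from a point `p` to the next point `q` in the positive
direction. -/
def gapLengths (P : Finset ℝ) : Finset ℝ :=
  ((P ×ˢ P).filter fun pq => ∀ r ∈ P, arcLength pq.1 pq.2 ≤ arcLength pq.1 r).image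
    fun pq => arcLength pq.1 pq.2

/-- Positive integers `N₁ < N₂ < …` such that for every `i` the set of the first `N i` points of
the sequence `x` has exactly `s` different gap lengths. -/
structure GapFamily (x : ℕ → ℝ) (s : ℕ) where
  N : ℕ → ℕ
  pos : ∀ i, 0 < N i
  strictMono : StrictMono N
  card_gapLengths : ∀ i, (gapLengths (firstPoints x (N i))).card = s

namespace GapFamily

variable {x : ℕ → ℝ} {s : ℕ}

/-- The gap lengths `L₁ < L₂ < … < L_s` at stage `i` in increasing order (here `j` runs through
`0, …, s - 1`). -/
def gap (F : GapFamily x s) (i : ℕ) (j : Fin s) : ℝ :=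
  (gapLengths (firstPoints x (F.N i))).orderEmbOfFin (F.card_gapLengths i) j

/-- The `j`-th gap length is `α`-small: `N_i ^ α * L_j → 0`. -/
def IsSmall (F : GapFamily x s) (α : ℝ) (j : Fin s) : Prop :=
  Tendsto (fun i => (F.N i : ℝ) ^ α * F.gap i j) atTop (𝓝 0)

/-- The `j`-th gap length is `α`-intermediate: `K₁ / N_i ^ α ≤ L_j ≤ K₂ / N_i ^ α` for all `i`,
with positive constants `K₁`, `K₂`. -/
def IsIntermediate (F : GapFamily x s) (α : ℝ) (j : Fin s) : Prop :=
  ∃ K₁ K₂ : ℝ, 0 < K₁ ∧ 0 < K₂ ∧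
    ∀ i, K₁ / (F.N i : ℝ) ^ α ≤ F.gap i j ∧ F.gap i j ≤ K₂ / (F.N i : ℝ) ^ α

/-- The `j`-th gap length is the largest one that is `α`-small. -/
def IsLargestSmall (F : GapFamily x s) (α : ℝ) (j : Fin s) : Prop :=
  F.IsSmall α j ∧ ∀ k, j < k → ¬ F.IsSmall α k

end GapFamily

/-- Obstruction 1 for the exponent `α`: there is an `α`-intermediate gap length. -/
def Obstruction1 (x : ℕ → ℝ) (α : ℝ) : Prop :=
  ∃ (s : ℕ) (F : GapFamily x s) (j : Fin s), F.IsIntermediate α j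

/-- Obstruction 2 for the exponent `α`: the largest `α`-small gap length is `1`-small. -/
def Obstruction2 (x : ℕ → ℝ) (α : ℝ) : Prop :=
  ∃ (s : ℕ) (F : GapFamily x s) (j : Fin s), F.IsLargestSmall α j ∧ F.IsSmall 1 j

end

open Filter Topology

/-! For irrational `z`, Liouville's inequality in degree two makes `z` badly approximable. Every gap
of the first `N` points then lies between two positive constants times `1 / N`
(`le_of_mem_gapLengths`, `le_div_of_mem_gapLengths`), so none is of order `N ^ (-α)` with `α < 1`,
and none is `o(1 / N)`. For rational `z` the gaps are bounded below by a positive constant, which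
excludes both behaviours as well. -/

theorem arcLength_pos (p q : ℝ) : 0 < arcLength p q := by
  unfold arcLength
  linarith [Int.fract_lt_one (p - q)]

theorem arcLength_le_one (p q : ℝ) : arcLength p q ≤ 1 := by
  unfold arcLength
  linarith [Int.fract_nonneg (p - q)]

theorem exists_arcLength_kronecker_eq (z : ℝ) (n m : ℕ) :
    ∃ k : ℤ, arcLength (kronecker z n) (kronecker z m) = ((m : ℝ) - n) * z + k := by
  refine ⟨1 + ⌊(n : ℝ) * z⌋ - ⌊(m : ℝ) * z⌋ + ⌊kronecker z n - kronecker z m⌋, ?_⟩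
  unfold arcLength
  rw [Int.fract]
  unfold kronecker
  push_cast [Int.fract]
  ring

/-- A representative in `(0, 1]` of the difference of two points is the length of the arc. -/
theorem arcLength_kronecker_of_mem (z : ℝ) (n m : ℕ) (k : ℤ)
    (h0 : 0 < ((m : ℝ) - n) * z + k) (h1 : ((m : ℝ) - n) * z + k ≤ 1) :
    arcLength (kronecker z n) (kronecker z m) = ((m : ℝ) - n) * z + k := by
  obtain ⟨l, hl⟩ := exists_arcLength_kronecker_eq z n m
  have hp := arcLength_pos (kronecker z n) (kronecker z m)
  have hle := arcLength_le_one (kronecker z n) (kronecker z m)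
  rw [hl] at hp hle
  have h2 : (l : ℝ) < k + 1 := by linarith
  have h3 : (k : ℝ) < l + 1 := by linarith
  have h4 : l = k := by
    have h2' : l < k + 1 := by exact_mod_cast h2
    have h3' : k < l + 1 := by exact_mod_cast h3
    omega
  rw [hl, h4]

/-- Every gap length of the first `N` points is the arc from some point of index at most `N` to
another one, and is minimal among the arcs from that point. -/
theorem exists_of_mem_gapLengths {x : ℕ → ℝ} {N : ℕ} {L : ℝ}
    (hL : L ∈ gapLengths (firstPoints x N)) :
    ∃ n m : ℕ, (1 ≤ n ∧ n ≤ N) ∧ (1 ≤ m ∧ m ≤ N) ∧ L = arcLength (x n) (x m) ∧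
      ∀ r, 1 ≤ r → r ≤ N → L ≤ arcLength (x n) (x r) := by
  obtain ⟨⟨p, q⟩, hpq, rfl⟩ := Finset.mem_image.1 hL
  obtain ⟨hmem, hmin⟩ := Finset.mem_filter.1 hpq
  obtain ⟨hp, hq⟩ := Finset.mem_product.1 hmem
  obtain ⟨n, hn, rfl⟩ := Finset.mem_image.1 hp
  obtain ⟨m, hm, rfl⟩ := Finset.mem_image.1 hq
  exact ⟨n, m, Finset.mem_Icc.1 hn, Finset.mem_Icc.1 hm, rfl, fun r h1 h2 =>
    hmin _ (Finset.mem_image_of_mem x (Finset.mem_Icc.2 ⟨h1, h2⟩))⟩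

/-- Arcs are positive and are integer combinations of `r` and `1`, hence integer multiples of `1 /
r.den`. -/
theorem inv_den_le_of_mem_gapLengths (r : ℚ) {N : ℕ} {L : ℝ}
    (hL : L ∈ gapLengths (firstPoints (kronecker r) N)) : 1 / (r.den : ℝ) ≤ L := by
  obtain ⟨n, m, -, -, rfl, -⟩ := exists_of_mem_gapLengths hL
  obtain ⟨k, hk⟩ := exists_arcLength_kronecker_eq r n m
  have hp := arcLength_pos (kronecker r n) (kronecker r m)
  have hd : (0 : ℝ) < r.den := by exact_mod_cast r.pos
  rw [hk] at hp ⊢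
  have hr : (r : ℝ) * r.den = r.num := by exact_mod_cast Rat.mul_den_eq_num r
  have key : (((m : ℝ) - n) * r + k) * r.den = (((m : ℤ) - n) * r.num + k * r.den : ℤ) := by
    push_cast
    rw [← hr]
    ring
  have h1 := mul_pos hp hd
  rw [key] at h1
  have h2 : (1 : ℤ) ≤ ((m : ℤ) - n) * r.num + k * r.den := by exact_mod_cast h1
  rw [div_le_iff₀ hd, key]
  exact_mod_cast h2

/-! ### Bad approximability and the lower bound for gaps -/

/-- Badly approximable numbers: `|q z - a| ≥ c / q` for all integers `a` and `q ≥ 1`. -/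
def BadlyApproximableWith (z c : ℝ) : Prop :=
  ∀ (q : ℕ) (a : ℤ), 0 < q → c / q ≤ |(q : ℝ) * z - a|

/-- Liouville's inequality for quadratic irrationals. -/
theorem exists_badlyApproximableWith {z : ℝ} (hirr : Irrational z) (hz : IsAlgebraic ℚ z)
    (hdeg : (minpoly ℚ z).natDegree ≤ 2) : ∃ c, 0 < c ∧ BadlyApproximableWith z c := by
  set f := IsLocalization.integerNormalization (nonZeroDivisors ℤ) (minpoly ℚ z)
  have f0 : f ≠ 0 :=
    mt IsFractionRing.integerNormalization_eq_zero_iff.1 (minpoly.ne_zero hz.isIntegral)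
  have hroot : Polynomial.aeval z f = 0 :=
    IsLocalization.integerNormalization_aeval_eq_zero _ _ (minpoly.aeval ℚ z)
  have hfdeg : f.natDegree ≤ 2 := by
    refine le_trans ?_ hdeg
    exact Polynomial.natDegree_le_natDegree (Finset.sup_mono
      (IsLocalization.integerNormalization_support (nonZeroDivisors ℤ) (minpoly ℚ z)))
  obtain ⟨A, hA, h⟩ := Liouville.exists_pos_real_of_irrational_root hirr f0
    (by rwa [Polynomial.eval_map_algebraMap])
  refine ⟨1 / A, one_div_pos.2 hA, fun q a hq => ?_⟩
  obtain ⟨b, rfl⟩ : ∃ b, q = b + 1 := ⟨q - 1, by omega⟩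
  have hb : (0 : ℝ) < (b : ℝ) + 1 := by positivity
  have hb1 : (1 : ℝ) ≤ (b : ℝ) + 1 := by linarith [Nat.cast_nonneg (α := ℝ) b]
  have e : |((b : ℝ) + 1) * z - a| = (b + 1) * |z - a / (b + 1)| := by
    rw [← abs_of_pos hb, ← abs_mul, abs_of_pos hb]
    congr 1
    field_simp
  push_cast
  rw [e, div_div, div_le_iff₀ (by positivity)]
  -- Of the two factors `b + 1`, one turns `|z - a / q|` into `|q z - a|`, the other gives the `q`
  -- in `c / q`.
  calc (1 : ℝ) ≤ (b + 1) ^ f.natDegree * (|z - a / (b + 1)| * A) := h a b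
    _ ≤ (b + 1) ^ 2 * (|z - a / (b + 1)| * A) := by gcongr
    _ = _ := by ring

/-- An arc between distinct indices is `|q z - a|` with `q < N`. The minimum with `1` covers the
full-circle arc from a point to itself. -/
theorem le_of_mem_gapLengths {z c : ℝ} (hc : 0 < c) (hz : BadlyApproximableWith z c) {N : ℕ}
    {L : ℝ} (hL : L ∈ gapLengths (firstPoints (kronecker z) N)) : min c 1 / N ≤ L := by
  obtain ⟨n, m, ⟨hn1, hn⟩, ⟨hm1, hm⟩, rfl, -⟩ := exists_of_mem_gapLengths hL
  have hN : (1 : ℝ) ≤ N := by exact_mod_cast hn1.trans hn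
  have hN0 : (0 : ℝ) < N := by linarith
  obtain ⟨k, hk⟩ := exists_arcLength_kronecker_eq z n m
  have hp := arcLength_pos (kronecker z n) (kronecker z m)
  have aux : ∀ (q : ℕ) (a : ℤ), 0 < q → q ≤ N → min c 1 / N ≤ |(q : ℝ) * z - a| := by
    intro q a hq hqN
    refine le_trans ?_ (hz q a hq)
    have : (0 : ℝ) < q := by exact_mod_cast hq
    have : (q : ℝ) ≤ N := by exact_mod_cast hqN
    exact div_le_div₀ hc.le (min_le_left _ _) (by assumption) this
  rcases lt_trichotomy n m with h | rfl | h
  · have := aux (m - n) (-k) (by omega) (by omega)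
    rw [Nat.cast_sub h.le] at this
    push_cast at this
    rwa [sub_neg_eq_add, ← hk, abs_of_pos hp] at this
  · have : arcLength (kronecker z n) (kronecker z n) = 1 := by simp [arcLength]
    rw [this, div_le_one hN0]
    exact (min_le_right _ _).trans hN
  · have := aux (n - m) k (by omega) (by omega)
    rw [Nat.cast_sub h.le, abs_sub_comm] at this
    have e : (k : ℝ) - ((n : ℝ) - m) * z = arcLength (kronecker z n) (kronecker z m) := by
      rw [hk]; ring
    rwa [e, abs_of_pos hp] at this

/-! ### Two-sided approximation and the upper bound for gaps -/

/-- If `q z` is close to an integer coprime to `q`, then some `j z` with `1 ≤ j ≤ q` lies at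
distance less than `1 / q` from an integer, on a prescribed side. -/
theorem exists_multiple_of_coprime {z : ℝ} {q : ℕ} {p : ℤ} (hq : 0 < q)
    (hcop : IsCoprime p (q : ℤ)) (hpos : 0 < (q : ℝ) * z - p) (hlt : (q : ℝ) * z - p < 1 / q) :
    ∃ (j : ℕ) (a : ℤ), 0 < j ∧ j ≤ q ∧ 0 < a - (j : ℝ) * z ∧ a - (j : ℝ) * z < 1 / q := by
  obtain ⟨u, v, huv⟩ := hcop
  have hqz : (0 : ℤ) < q := by exact_mod_cast hq
  have hqr : (0 : ℝ) < q := by exact_mod_cast hq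
  -- `j ∈ [1, q]` with `j ≡ -u` modulo `q`
  obtain ⟨j, hj0, hjq, a, ha⟩ : ∃ j : ℕ, 0 < j ∧ j ≤ q ∧ ∃ a : ℤ, a * q - j * p = 1 := by
    have h1 := Int.emod_nonneg (-u - 1) hqz.ne'
    have h2 := Int.emod_lt_of_pos (-u - 1) hqz
    have h3 := Int.emod_add_mul_ediv (-u - 1) q
    -- Shifting by one before and after reduction puts the residue of `-u` in `[1, q]` instead of
    -- `[0, q - 1]`.
    refine ⟨((-u - 1) % q + 1).toNat, by omega, by omega, v - (-u - 1) / q * p, ?_⟩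
    rw [Int.toNat_of_nonneg (by omega)]
    linear_combination huv - p * h3
  have har : (a : ℝ) * q - j * p = 1 := by exact_mod_cast ha
  have hj0' : (0 : ℝ) < j := by exact_mod_cast hj0
  have hjq' : (j : ℝ) ≤ q := by exact_mod_cast hjq
  have e : a - (j : ℝ) * z = (1 - j * (q * z - p)) / q := by
    field_simp
    linarith
  have h1 : (j : ℝ) * (q * z - p) < 1 := by
    calc (j : ℝ) * (q * z - p) ≤ q * (q * z - p) := by gcongr
      _ < q * (1 / q) := by gcongr
      _ = 1 := by field_simp
  refine ⟨j, a, hj0, hjq, ?_, ?_⟩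
  · rw [e]; exact div_pos (by linarith) hqr
  · rw [e]; gcongr
    linarith [mul_pos hj0' hpos]

/-- One-sided approximations of comparable quality on both sides. -/
theorem BadlyApproximableWith.exists_two_sided {z c : ℝ} (hc : 0 < c)
    (hz : BadlyApproximableWith z c) {M : ℕ} (hM : 0 < M) :
    (∃ (q : ℕ) (a : ℤ), 0 < q ∧ q ≤ M ∧ 0 < (q : ℝ) * z - a ∧ (q : ℝ) * z - a ≤ 1 ∧
      (q : ℝ) * z - a ≤ max 1 (1 / c) / M) ∧
    (∃ (q : ℕ) (a : ℤ), 0 < q ∧ q ≤ M ∧ 0 < a - (q : ℝ) * z ∧ a - (q : ℝ) * z ≤ 1 ∧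
      a - (q : ℝ) * z ≤ max 1 (1 / c) / M) := by
  obtain ⟨r, hr, hrM⟩ := Real.exists_rat_abs_sub_le_and_den_le z hM
  have hd : (0 : ℝ) < r.den := by exact_mod_cast r.pos
  have hd1 : (1 : ℝ) ≤ r.den := by exact_mod_cast r.pos
  have hMr : (0 : ℝ) < M := by exact_mod_cast hM
  have hdM : (r.den : ℝ) ≤ M := by exact_mod_cast hrM
  have hclose : |(r.den : ℝ) * z - r.num| ≤ 1 / (M + 1) := by
    have e : (r.den : ℝ) * z - r.num = r.den * (z - r) := by
      have : (r : ℝ) * r.den = r.num := by exact_mod_cast Rat.mul_den_eq_num r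
      rw [← this]; ring
    rw [e, abs_mul, abs_of_pos hd]
    calc (r.den : ℝ) * |z - r| ≤ r.den * (1 / ((M + 1) * r.den)) := by gcongr
      _ = 1 / (M + 1) := by field_simp
  have hlow := hz r.den r.num r.pos
  -- Bad approximability forces the Dirichlet denominator to be at least `c * M`, so the error `1 /
  -- r.den` on the opposite side is still `O(1 / M)`.
  have hden : 1 / (r.den : ℝ) ≤ 1 / c / M := by
    have h1 : c / r.den ≤ 1 / M :=
      (hlow.trans hclose).trans (by gcongr; linarith)
    rw [div_le_div_iff₀ hd hMr] at h1
    rw [div_div, div_le_div_iff₀ hd (by positivity)]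
    linarith
  have hd_one : 1 / (r.den : ℝ) ≤ 1 := by rw [div_le_one hd]; exact hd1
  have hfar : (1 : ℝ) / (M + 1) < 1 / r.den := by gcongr; linarith
  have hM1 : (1 : ℝ) / (M + 1) ≤ max 1 (1 / c) / M := by
    gcongr
    · exact le_max_left _ _
    · linarith
  have hden' : 1 / (r.den : ℝ) ≤ max 1 (1 / c) / M :=
    hden.trans (by gcongr; exact le_max_right _ _)
  have hcop : IsCoprime r.num (r.den : ℤ) := Rat.isCoprime_num_den r
  have hne : (r.den : ℝ) * z - r.num ≠ 0 := by
    rw [← abs_pos]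
    exact (div_pos hc hd).trans_le hlow
  rcases hne.lt_or_gt with h | h
  · rw [abs_of_neg h] at hclose
    -- Passing to `-z` exchanges the two sides.
    obtain ⟨j, a, hj0, hjq, ha0, ha1⟩ := exists_multiple_of_coprime (z := -z) (p := -r.num) r.pos
      hcop.neg_left (by push_cast; linarith) (by push_cast; linarith)
    refine ⟨⟨j, -a, hj0, hjq.trans hrM, ?_, ?_, ?_⟩,
      ⟨r.den, r.num, r.pos, hrM, ?_, ?_, ?_⟩⟩ <;> push_cast <;> linarith
  · rw [abs_of_pos h] at hclose
    obtain ⟨j, a, hj0, hjq, ha0, ha1⟩ := exists_multiple_of_coprime r.pos hcop h (by linarith)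
    refine ⟨⟨r.den, r.num, r.pos, hrM, ?_, ?_, ?_⟩,
      ⟨j, a, hj0, hjq.trans hrM, ?_, ?_, ?_⟩⟩ <;> linarith

/-- With shifts of at most `N / 2`, an index in the lower half can move up and one in the upper half
can move down without leaving `[1, N]`. Both moves advance the point in the positive direction,
whence the need for approximations from both sides. -/
theorem le_div_of_mem_gapLengths {z c : ℝ} (hc : 0 < c) (hz : BadlyApproximableWith z c) {N : ℕ}
    {L : ℝ} (hL : L ∈ gapLengths (firstPoints (kronecker z) N)) :
    L ≤ 3 * max 1 (1 / c) / N := by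
  obtain ⟨n, m, ⟨hn1, hn⟩, -, hLe, hmin⟩ := exists_of_mem_gapLengths hL
  have hC : (1 : ℝ) ≤ max 1 (1 / c) := le_max_left _ _
  obtain rfl | hN2 : N = 1 ∨ 2 ≤ N := by omega
  · rw [hLe]
    refine (arcLength_le_one _ _).trans ?_
    push_cast
    linarith
  have hM : 0 < N / 2 := by omega
  -- The floor in `N / 2` costs the constant `3`, attained at `N = 3`.
  have hM3 : (N : ℝ) ≤ 3 * (N / 2 : ℕ) := by
    have : N ≤ 3 * (N / 2) := by omega
    exact_mod_cast this
  have hM0 : (0 : ℝ) < (N / 2 : ℕ) := by exact_mod_cast hM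
  have hN0 : (0 : ℝ) < N := by exact_mod_cast (by omega : 0 < N)
  have hfin : max 1 (1 / c) / (N / 2 : ℕ) ≤ 3 * max 1 (1 / c) / N := by
    rw [div_le_div_iff₀ hM0 hN0]
    nlinarith
  obtain ⟨⟨q, a, hq0, hqM, h1, h2, h3⟩, ⟨q', a', hq0', hqM', h1', h2', h3'⟩⟩ :=
    hz.exists_two_sided hc hM
  by_cases hnM : n ≤ N / 2
  · have e : (((n + q : ℕ) : ℝ) - n) * z + ((-a : ℤ) : ℝ) = q * z - a := by push_cast; ring
    refine (hmin (n + q) (by omega) (by omega)).trans ?_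
    rw [arcLength_kronecker_of_mem z n (n + q) (-a) (by rwa [e]) (by rwa [e]), e]
    exact h3.trans hfin
  · have e : (((n - q' : ℕ) : ℝ) - n) * z + ((a' : ℤ) : ℝ) = a' - q' * z := by
      rw [Nat.cast_sub (by omega)]; ring
    refine (hmin (n - q') (by omega) (by omega)).trans ?_
    rw [arcLength_kronecker_of_mem z n (n - q') a' (by rwa [e]) (by rwa [e]), e]
    exact h3'.trans hfin

/-! ### Asymptotics along a family of gaps -/

namespace GapFamily

variable {x : ℕ → ℝ} {s : ℕ}

theorem gap_mem (F : GapFamily x s) (i : ℕ) (j : Fin s) :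
    F.gap i j ∈ gapLengths (firstPoints x (F.N i)) :=
  Finset.orderEmbOfFin_mem _ _ _

theorem tendsto_N (F : GapFamily x s) : Tendsto (fun i => (F.N i : ℝ)) atTop atTop :=
  tendsto_natCast_atTop_atTop.comp F.strictMono.tendsto_atTop

theorem not_isSmall_one_of_le (F : GapFamily x s) (j : Fin s) {c : ℝ} (hc : 0 < c)
    (h : ∀ i, c ≤ F.N i * F.gap i j) : ¬ F.IsSmall 1 j := by
  intro hs
  have := ge_of_tendsto' hs (b := c) fun i => by simpa using h i
  linarith

/-- A gap length `O (1 / N)` is not `α`-intermediate. -/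
theorem not_isIntermediate_of_le (F : GapFamily x s) (j : Fin s) {α C : ℝ} (hα : α < 1)
    (h : ∀ i, F.gap i j ≤ C / F.N i) : ¬ F.IsIntermediate α j := by
  rintro ⟨K₁, K₂, hK₁, -, hK⟩
  have ht : Tendsto (fun i => (F.N i : ℝ) ^ (1 - α)) atTop atTop :=
    (tendsto_rpow_atTop (by linarith)).comp F.tendsto_N
  obtain ⟨i, hi⟩ := (ht.eventually_gt_atTop (C / K₁)).exists
  have hN : (0 : ℝ) < F.N i := by exact_mod_cast F.pos i
  have h1 := (hK i).1.trans (h i)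
  rw [div_lt_iff₀ hK₁, Real.rpow_sub hN, Real.rpow_one] at hi
  have hp := Real.rpow_pos_of_pos hN α
  rw [div_le_div_iff₀ hp hN] at h1
  rw [div_mul_eq_mul_div, lt_div_iff₀ hp] at hi
  linarith

theorem not_isIntermediate_of_const_le (F : GapFamily x s) (j : Fin s) {α c : ℝ} (hα : 0 < α)
    (hc : 0 < c) (h : ∀ i, c ≤ F.gap i j) : ¬ F.IsIntermediate α j := by
  rintro ⟨K₁, K₂, -, -, hK⟩
  have ht : Tendsto (fun i => K₂ / (F.N i : ℝ) ^ α) atTop (𝓝 0) :=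
    Tendsto.const_div_atTop ((tendsto_rpow_atTop hα).comp F.tendsto_N) K₂
  have := ge_of_tendsto' ht (b := c) fun i => (h i).trans (hK i).2
  linarith

end GapFamily

theorem mainTheorem6 (z : ℝ) (hz : IsAlgebraic ℚ z) (hdeg : (minpoly ℚ z).natDegree ≤ 2)
    (α : ℝ) (hα0 : 0 < α) (hα1 : α < 1) :
    ¬ Obstruction1 (kronecker z) α ∧ ¬ Obstruction2 (kronecker z) α := by
  by_cases hirr : Irrational z
  · obtain ⟨c, hc, hbad⟩ := exists_badlyApproximableWith hirr hz hdeg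
    constructor
    · rintro ⟨s, F, j, hj⟩
      exact F.not_isIntermediate_of_le j hα1
        (fun i => le_div_of_mem_gapLengths hc hbad (F.gap_mem i j)) hj
    · rintro ⟨s, F, j, -, hj⟩
      refine F.not_isSmall_one_of_le j (lt_min hc one_pos) (fun i => ?_) hj
      have hN : (0 : ℝ) < F.N i := by exact_mod_cast F.pos i
      have := le_of_mem_gapLengths hc hbad (F.gap_mem i j)
      rwa [div_le_iff₀' hN] at this
  · obtain ⟨r, rfl⟩ : ∃ r : ℚ, (r : ℝ) = z := by simpa [Irrational] using hirr
    have hr : (0 : ℝ) < 1 / r.den := one_div_pos.2 (by exact_mod_cast r.pos)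
    constructor
    · rintro ⟨s, F, j, hj⟩
      exact F.not_isIntermediate_of_const_le j hα0 hr
        (fun i => inv_den_le_of_mem_gapLengths r (F.gap_mem i j)) hj
    · rintro ⟨s, F, j, -, hj⟩
      refine F.not_isSmall_one_of_le j hr (fun i => ?_) hj
      have hN : (1 : ℝ) ≤ F.N i := by exact_mod_cast F.pos i
      have := inv_den_le_of_mem_gapLengths r (F.gap_mem i j)
      nlinarith
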